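/- Let $\mathbb D$ be the open unit disk and $\hat{\mathbb C}=\mathbb C\cup\{\infty\}$ the Riemann sphere. For a compact set $K\subset\mathbb C$, the analytic capacity of $K$ is $\gamma(K):=\sup_g|g'(\infty)|$, where the supremum is over all holomorphic $g:\hat{\mathbb C}\setminus K\to\mathbb D$ and $g'(\infty):=\lim_{z\to\infty}z(g(z)-g(\infty))$. A holomorphic motion of $\hat{\mathbb C}$ is a map $f:\mathbb D\times\hat{\mathbb C}\to\hat{\mathbb C}$, written $f_\lambda(z)=f(\lambda,z)$, such that $\lambda\mapsto f(\lambda,z)$ is holomorphic on $\mathbb D$ for each $z$, $f_\lambda$ is injective for each $\lambda$, and $f_0(z)=z$ for all $z$. Let $K\subset\mathbb C$ be compact with $\gamma(K)>0$. Let $f:\mathbb D\times\hat{\mathbb C}\to\hat{\mathbb C}$ be a holomorphic motion such that, for each $\lambda\in\mathbb D$, the map $f_\lambda$ is holomorphic on $\hat{\mathbb C}\setminus K$ and $f_\lambda(\infty)=\infty$. Write $K_\lambda:=f_\lambda(K)$, and let $M$ be a real number with $\gamma(K_\lambda)\le M$ for all $\lambda\in\mathbb D$. Then, for every $\lambda\in\mathbb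 D$, the set $K_\lambda$ is a compact subset of $\mathbb C$ with $\gamma(K_\lambda)>0$, and, if $\gamma(K)<M$, \[ \frac{1-|\lambda|}{1+|\lambda|}\le\frac{\log(M/\gamma(K_\lambda))}{\log(M/\gamma(K))}\le\frac{1+|\lambda|}{1-|\lambda|}, \] while, if $\gamma(K)=M$, then $\gamma(K_\lambda)=M$. -/

import Mathlib

open Filter Topology Bornology
open scoped Manifold ContDiff

/-- The Riemann sphere `ℂ ∪ {∞}`, with the topology of the one-point compactification. -/
abbrev RiemannSphere : Type := OnePoint ℂ

namespace RiemannSphere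

/-- The affine chart `z ↦ z` on `ℂ`. -/
noncomputable def chartFinite : OpenPartialHomeomorph RiemannSphere ℂ where
  toFun p := p.elim 0 id
  invFun z := (z : RiemannSphere)
  source := {OnePoint.infty}ᶜ
  target := Set.univ
  map_source' _ _ := Set.mem_univ _
  map_target' z _ := OnePoint.coe_ne_infty z
  left_inv' p hp := by
    induction p using OnePoint.rec with
    | infty => exact absurd rfl hp
    | coe z => rfl
  right_inv' _ _ := rfl
  open_source := isOpen_compl_singleton
  open_target := isOpen_univ
  continuousOn_toFun := by
    intro p hp
    induction p using OnePoint.rec with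
    | infty => exact absurd rfl hp
    | coe z =>
      refine ContinuousAt.continuousWithinAt ?_
      rw [OnePoint.continuousAt_coe]
      exact continuousAt_id
  continuousOn_invFun := OnePoint.continuous_coe.continuousOn

/-- The chart `z ↦ 1 / z` on `(ℂ ∖ {0}) ∪ {∞}`, sending `∞` to `0`. -/
noncomputable def chartInfty : OpenPartialHomeomorph RiemannSphere ℂ where
  toFun p := p.elim 0 (fun z => z⁻¹)
  invFun w := open Classical in if w = 0 then OnePoint.infty else ((w⁻¹ : ℂ) : RiemannSphere)
  source := {((0 : ℂ) : RiemannSphere)}ᶜ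
  target := Set.univ
  map_source' _ _ := Set.mem_univ _
  map_target' w _ := by
    by_cases hw : w = 0
    · simp [hw]
    · simp [hw]
  left_inv' p hp := by
    induction p using OnePoint.rec with
    | infty => simp
    | coe z =>
      have hz : z ≠ 0 := fun h => hp (by simp [h])
      simp [hz]
  right_inv' w _ := by
    by_cases hw : w = 0
    · simp [hw]
    · simp [hw]
  open_source := isOpen_compl_singleton
  open_target := isOpen_univ
  continuousOn_toFun := by
    intro p hp
    induction p using OnePoint.rec with
    | infty =>
      refine ContinuousAt.continuousWithinAt ?_
      rw [OnePoint.continuousAt_infty']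
      simpa [coclosedCompact_eq_cocompact, ← Metric.cobounded_eq_cocompact, Function.comp_def]
        using tendsto_inv₀_cobounded (α := ℂ)
    | coe z =>
      have hz : z ≠ 0 := fun h => hp (by simp [h])
      exact (OnePoint.continuousAt_coe.2 (continuousAt_inv₀ hz)).continuousWithinAt
  continuousOn_invFun := by
    refine Continuous.continuousOn (continuous_iff_continuousAt.2 fun w => ?_)
    by_cases hw : w = 0
    · subst hw
      rw [continuousAt_iff_punctured_nhds]
      have h : Tendsto (fun w : ℂ => ((w⁻¹ : ℂ) : RiemannSphere)) (𝓝[≠] 0)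
          (𝓝 OnePoint.infty) := by
        refine OnePoint.tendsto_coe_infty.comp ?_
        simpa [coclosedCompact_eq_cocompact, ← Metric.cobounded_eq_cocompact]
          using tendsto_inv₀_nhdsNE_zero (α := ℂ)
      simp only [if_true]
      refine h.congr' ?_
      filter_upwards [self_mem_nhdsWithin] with w hw
      exact (if_neg hw).symm
    · have h : ContinuousAt (fun w : ℂ => ((w⁻¹ : ℂ) : RiemannSphere)) w :=
        OnePoint.continuous_coe.continuousAt.comp (continuousAt_inv₀ hw)
      refine h.congr ?_
      filter_upwards [isOpen_ne.mem_nhds hw] with v hv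
      exact (if_neg hv).symm

/-- The two charts `z` and `1 / z` as an atlas of the Riemann sphere. -/
noncomputable instance : ChartedSpace ℂ RiemannSphere where
  atlas := {chartFinite, chartInfty}
  chartAt p := open Classical in if p = OnePoint.infty then chartInfty else chartFinite
  mem_chart_source p := by
    induction p using OnePoint.rec with
    | infty => simp [chartInfty]
    | coe z => simp [chartFinite]
  chart_mem_atlas p := by
    by_cases hp : p = OnePoint.infty
    · simp [hp]
    · simp [hp]

/-- The transition maps are analytic, so the Riemann sphere is a complex manifold. -/
instance : IsManifold 𝓘(ℂ) ω RiemannSphere := by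
  have key : ∀ s : Set ℂ, s ⊆ {0}ᶜ → ContDiffOn ℂ ω (fun z : ℂ => z⁻¹) s := fun s hs z hz =>
    (contDiffAt_inv ℂ (hs hz)).contDiffWithinAt
  refine isManifold_of_contDiffOn _ _ _ ?_
  intro e e' he he'
  simp only [modelWithCornersSelf_coe, modelWithCornersSelf_coe_symm,
    Set.preimage_id, Set.range_id, Set.inter_univ, CompTriple.comp_eq]
  rcases he with rfl | rfl <;> rcases he' with rfl | rfl
  · exact contDiffOn_id.congr fun z _ => rfl
  · refine (key _ ?_).congr fun z _ => rfl
    intro z hz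
    rintro rfl
    exact hz.2 rfl
  · have hs : (chartInfty.symm.trans chartFinite).source ⊆ {0}ᶜ := by
      intro z hz h0
      simp only [Set.mem_singleton_iff] at h0
      subst h0
      exact hz.2 (if_pos rfl)
    refine (key _ hs).congr fun z hz => ?_
    have hz0 : z ≠ 0 := hs hz
    change OnePoint.elim (open Classical in
      if z = 0 then OnePoint.infty else ((z⁻¹ : ℂ) : RiemannSphere)) 0 id = z⁻¹
    simp [hz0]
  · refine contDiffOn_id.congr fun z _ => ?_
    exact chartInfty.right_inv (Set.mem_univ z)

end RiemannSphere

/-- A holomorphic motion `f : 𝔻 × A → ℂ ∪ {∞}` of a subset `A` of the Riemann sphere, written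
`f lam z`; only the values for `lam` in the open unit disk and `z ∈ A` matter. -/
structure IsHolomorphicMotion (A : Set RiemannSphere)
    (f : ℂ → RiemannSphere → RiemannSphere) : Prop where
  holomorphic : ∀ z ∈ A, MDifferentiableOn 𝓘(ℂ) 𝓘(ℂ) (fun lam => f lam z) (Metric.ball 0 1)
  injOn : ∀ lam ∈ Metric.ball (0 : ℂ) 1, Set.InjOn (f lam) A
  map_zero : ∀ z ∈ A, f 0 z = z

/-- The complement `(ℂ ∪ {∞}) ∖ K` of a set `K ⊆ ℂ` in the Riemann sphere. -/
def sphereCompl (K : Set ℂ) : Set RiemannSphere :=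
  ((fun z : ℂ => (z : RiemannSphere)) '' K)ᶜ

/-- The analytic capacity `γ(K) = sup |g'(∞)|` of a compact set `K ⊆ ℂ`, the supremum being over
the holomorphic `g : (ℂ ∪ {∞}) ∖ K → 𝔻`, where `g'(∞) = lim_{z → ∞} z (g z - g ∞)`. -/
noncomputable def analyticCapacity (K : Set ℂ) : ℝ :=
  sSup {r : ℝ | ∃ (g : RiemannSphere → ℂ) (d : ℂ),
    MDifferentiableOn 𝓘(ℂ) 𝓘(ℂ) g (sphereCompl K) ∧
    (∀ p ∈ sphereCompl K, ‖g p‖ < 1) ∧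
    Tendsto (fun z : ℂ => z * (g (z : RiemannSphere) - g OnePoint.infty)) (cobounded ℂ) (𝓝 d) ∧
    r = ‖d‖}

/-- The set `K_λ = f_λ(K)`, as a set of complex numbers; nothing is lost by this when
`∞ ∉ f_λ(K)`. -/
def movedSet (f : ℂ → RiemannSphere → RiemannSphere) (K : Set ℂ) (lam : ℂ) : Set ℂ :=
  {w : ℂ | ∃ z ∈ K, f lam (z : RiemannSphere) = (w : RiemannSphere)}

/-! Let `a(λ)` be the derivative of `f_λ` at `∞`, that is `lim f_λ(z) / z`. Since `f_λ` is conformal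
off `K`, composition with it rescales the competitors for analytic capacity, so `γ(K_λ) = |a(λ)|
γ(K)` (`analyticCapacity_eq_norm_mul`). The function `a` is holomorphic and zero-free, `a(0) = 1`,
and `|a| ≤ M / γ(K)`. Hence `log (M / γ(K_λ))` is a nonnegative harmonic function of `λ`, and the
estimate is Harnack's inequality (`harnack_log_norm`).

Two points need work. For `a` to be holomorphic in `λ`, the limit at `∞` must be suitably uniform in
`λ`; a Koebe covering theorem gives growth bounds whose constants do not depend on the map
(`growth_of_injective`, `differentiableOn_invDerivInfty`). For the capacity formula, `f_λ` must be a
homeomorphism of the sphere. Its continuity is a form of the λ-lemma: Harnack's inequality, applied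
in `λ` to normalised differences `f_λ(w) - f_λ(z)`, gives a Hölder bound (`continuous_of_motion`).
Surjectivity is a winding number argument (`surjective_of_tendsto_div`), and compactness of the
sphere makes the inverse continuous. -/

/-! ### Logarithms and Harnack's inequality -/

/-- A nonvanishing holomorphic function on a disk has a holomorphic logarithm. -/
theorem exists_differentiableOn_log_ball {φ : ℂ → ℂ} {r : ℝ}
    (hφ : DifferentiableOn ℂ φ (Metric.ball 0 r)) (h0 : ∀ z ∈ Metric.ball (0 : ℂ) r, φ z ≠ 0) :
    ∃ L : ℂ → ℂ, DifferentiableOn ℂ L (Metric.ball 0 r) ∧ L 0 = Complex.log (φ 0) ∧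
      ∀ z ∈ Metric.ball (0 : ℂ) r, Complex.exp (L z) = φ z := by
  have hd : DifferentiableOn ℂ (fun z => deriv φ z / φ z) (Metric.ball 0 r) :=
    (hφ.deriv Metric.isOpen_ball).div hφ h0
  obtain ⟨L, hL0, hL⟩ := hd.isExactOn_ball.with_val_at 0 (Complex.log (φ 0))
  refine ⟨L, fun z hz => (hL z hz).differentiableAt.differentiableWithinAt, hL0, fun z hz => ?_⟩
  have hr : (0 : ℂ) ∈ Metric.ball (0 : ℂ) r :=
    Metric.mem_ball_self ((dist_nonneg).trans_lt (Metric.mem_ball.1 hz))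
  have hder : ∀ w ∈ Metric.ball (0 : ℂ) r,
      HasDerivAt (fun z => φ z * Complex.exp (-L z)) 0 w := by
    intro w hw
    have h1 := (hφ.differentiableAt (Metric.isOpen_ball.mem_nhds hw)).hasDerivAt
    have h2 : HasDerivAt (fun z => Complex.exp (-L z))
        (Complex.exp (-L w) * -(deriv φ w / φ w)) w := (hL w hw).fun_neg.cexp
    refine (h1.fun_mul h2).congr_deriv ?_
    have := h0 w hw
    field_simp
    ring
  have := Metric.isOpen_ball.is_const_of_deriv_eq_zero (convex_ball (0 : ℂ) r).isPreconnected
    (fun w hw => (hder w hw).differentiableAt.differentiableWithinAt)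
    (fun w hw => (hder w hw).deriv) hz hr
  simp only [hL0, Complex.exp_neg, Complex.exp_log (h0 0 hr), mul_inv_cancel₀ (h0 0 hr)] at this
  have he := Complex.exp_ne_zero (L z)
  field_simp at this
  exact this.symm

/-- Harnack's inequality for the real part of a holomorphic function. -/
theorem harnack_re_of_pos {P : ℂ → ℂ} (hP : DifferentiableOn ℂ P (Metric.ball 0 1))
    (hpos : ∀ z ∈ Metric.ball (0 : ℂ) 1, 0 < (P z).re) {z : ℂ} (hz : z ∈ Metric.ball (0 : ℂ) 1) :
    (1 - ‖z‖) * (P z).re ≤ (1 + ‖z‖) * (P 0).re ∧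
      (1 - ‖z‖) * (P 0).re ≤ (1 + ‖z‖) * (P z).re := by
  have h00 := hpos 0 (by simp)
  set c := P 0 with hc
  have hne : ∀ w ∈ Metric.ball (0 : ℂ) 1, P w + (starRingEnd ℂ) c ≠ 0 := by
    intro w hw h
    have := congrArg Complex.re h
    simp at this
    linarith [hpos w hw]
  -- This Cayley transform takes the right half-plane to the disk and `c` to `0`, so the Schwarz
  -- lemma applies.
  have hdiff : DifferentiableOn ℂ (fun w => (P w - c) / (P w + (starRingEnd ℂ) c))
      (Metric.ball 0 1) := (hP.sub_const _).div (hP.add_const _) hne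
  have hsq : ∀ w : ℂ, ‖w‖ ^ 2 = w.re ^ 2 + w.im ^ 2 := fun w => by
    rw [Complex.sq_norm, Complex.normSq_apply]; ring
  have hmaps : Set.MapsTo (fun w => (P w - c) / (P w + (starRingEnd ℂ) c))
      (Metric.ball 0 1) (Metric.closedBall 0 1) := by
    intro w hw
    rw [mem_closedBall_zero_iff, norm_div, div_le_one (norm_pos_iff.2 (hne w hw))]
    refine le_of_sq_le_sq ?_ (norm_nonneg _)
    rw [hsq, hsq]
    simp
    nlinarith [hpos w hw, mul_pos (hpos w hw) h00]
  have hz1 : ‖z‖ < 1 := by simpa using hz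
  have hs := Complex.norm_le_norm_of_mapsTo_ball hdiff hmaps (by simp [← hc]) hz1
  rw [norm_div, div_le_iff₀ (norm_pos_iff.2 (hne z hz))] at hs
  have hs2 := pow_le_pow_left₀ (norm_nonneg _) hs 2
  rw [mul_pow, hsq, hsq (P z + _)] at hs2
  simp at hs2
  have hzp := hpos z hz
  have hn := norm_nonneg z
  -- `P z - c` and `P z + conj c` have the same imaginary part, which can be dropped because `‖z‖ <
  -- 1`.
  have key : |(P z).re - c.re| ≤ ‖z‖ * ((P z).re + c.re) := by
    refine abs_le_of_sq_le_sq ?_ (by positivity)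
    nlinarith [sq_nonneg ((P z).im - c.im), mul_nonneg (sq_nonneg ((P z).im - c.im))
      (by nlinarith : 0 ≤ 1 - ‖z‖ ^ 2)]
  rw [abs_le] at key
  constructor <;> nlinarith

/-- Harnack's inequality for `log (B / |φ|)`, where `φ` is holomorphic, nonvanishing and bounded
by `B` on the unit disk. -/
theorem harnack_log_norm {φ : ℂ → ℂ} {B : ℝ} (hφ : DifferentiableOn ℂ φ (Metric.ball 0 1))
    (h0 : ∀ z ∈ Metric.ball (0 : ℂ) 1, φ z ≠ 0) (hB : ∀ z ∈ Metric.ball (0 : ℂ) 1, ‖φ z‖ ≤ B)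
    {z : ℂ} (hz : z ∈ Metric.ball (0 : ℂ) 1) :
    (1 - ‖z‖) * Real.log (B / ‖φ z‖) ≤ (1 + ‖z‖) * Real.log (B / ‖φ 0‖) ∧
      (1 - ‖z‖) * Real.log (B / ‖φ 0‖) ≤ (1 + ‖z‖) * Real.log (B / ‖φ z‖) := by
  obtain ⟨L, hL, -, hexp⟩ := exists_differentiableOn_log_ball hφ h0
  have hmem : (0 : ℂ) ∈ Metric.ball (0 : ℂ) 1 := by simp
  have hBpos : 0 < B := (norm_pos_iff.2 (h0 0 hmem)).trans_le (hB 0 hmem)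
  have hre : ∀ w ∈ Metric.ball (0 : ℂ) 1,
      Real.log (B / ‖φ w‖) = Real.log B - (L w).re := by
    intro w hw
    rw [Real.log_div hBpos.ne' (norm_ne_zero_iff.2 (h0 w hw)), ← hexp w hw, Complex.norm_exp,
      Real.log_exp]
  have hnonneg : ∀ w ∈ Metric.ball (0 : ℂ) 1, 0 ≤ Real.log B - (L w).re := by
    intro w hw
    rw [← hre w hw]
    exact Real.log_nonneg ((one_le_div (norm_pos_iff.2 (h0 w hw))).2 (hB w hw))
  rw [hre z hz, hre 0 hmem]
  have hz1 : ‖z‖ < 1 := by simpa using hz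
  -- The harmonic function may vanish, as for constant `φ` of modulus `B`; adding `ε` makes it
  -- strictly positive.
  have main : ∀ ε : ℝ, 0 < ε →
      (1 - ‖z‖) * (Real.log B - (L z).re) ≤ (1 + ‖z‖) * (Real.log B - (L 0).re) + 2 * ε ∧
      (1 - ‖z‖) * (Real.log B - (L 0).re) ≤ (1 + ‖z‖) * (Real.log B - (L z).re) + 2 * ε := by
    intro ε hε
    have h := harnack_re_of_pos (P := fun w => ((Real.log B + ε : ℝ) : ℂ) - L w)
      (hL.const_sub _) (fun w hw => by
        have := hnonneg w hw
        simp only [Complex.sub_re, Complex.ofReal_re]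
        linarith) hz
    simp only [Complex.sub_re, Complex.ofReal_re] at h
    have hn := norm_nonneg z
    constructor <;> nlinarith [h.1, h.2]
  constructor
  · refine le_of_forall_pos_le_add fun ε hε => ?_
    linarith [(main (ε / 2) (by positivity)).1]
  · refine le_of_forall_pos_le_add fun ε hε => ?_
    linarith [(main (ε / 2) (by positivity)).2]

/-! ### Injective holomorphic functions and Koebe's theorem -/

/-- A holomorphic function that is injective near a point has nonzero derivative there. -/
theorem deriv_ne_zero_of_injOn_nhds {f : ℂ → ℂ} {c : ℂ} {s : Set ℂ} (hs : s ∈ 𝓝 c)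
    (hf : AnalyticAt ℂ f c) (hinj : Set.InjOn f s) : deriv f c ≠ 0 := by
  have hfc : AnalyticAt ℂ (fun z => f z - f c) c := hf.sub analyticAt_const
  have hnt : analyticOrderAt (fun z => f z - f c) c ≠ ⊤ := by
    rw [ne_eq, analyticOrderAt_eq_top]
    intro h
    have h2 : ∀ᶠ z in 𝓝[≠] c, False := by
      filter_upwards [nhdsWithin_le_nhds h, nhdsWithin_le_nhds hs, self_mem_nhdsWithin]
        with z hz hzs hzc
      exact hzc (hinj hzs (mem_of_mem_nhds hs) (sub_eq_zero.1 hz))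
    exact h2.exists.elim fun _ h => h
  obtain ⟨u, hu, hu0, hfu⟩ := hfc.analyticOrderAt_ne_top.1 hnt
  set n := analyticOrderNatAt (fun z => f z - f c) c with hn
  have hn0 : n ≠ 0 := by
    intro h
    have := hfu.self_of_nhds
    simp [h] at this
    exact hu0 this.symm
  -- an `n`-th root `v` of `u` near `c`
  let v : ℂ → ℂ := fun z => u c ^ (1 / n : ℂ) * (u z / u c) ^ (1 / n : ℂ)
  -- The quotient is `1` at `c`, away from the branch cut of the power.
  have hdiv : AnalyticAt ℂ (fun z => u z / u c) c := hu.div analyticAt_const hu0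
  have hv : AnalyticAt ℂ v c := by
    refine analyticAt_const.mul (hdiv.cpow analyticAt_const ?_)
    simp [hu0, Complex.one_mem_slitPlane]
  have hvn : ∀ z, v z ^ n = u z := by
    intro z
    simp only [v, mul_pow, ← Complex.cpow_mul_nat, one_div,
      inv_mul_cancel₀ (Nat.cast_ne_zero.2 hn0 : (n : ℂ) ≠ 0), Complex.cpow_one]
    field_simp
  have hv0 : v c ≠ 0 := by
    intro h
    have := hvn c
    rw [h, zero_pow hn0] at this
    exact hu0 this.symm
  let k : ℂ → ℂ := fun z => (z - c) * v z
  have hk : HasStrictDerivAt k (v c) c := by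
    have h1 : AnalyticAt ℂ k c := (analyticAt_id.sub analyticAt_const).mul hv
    have h2 : HasDerivAt k (v c) c := by
      have := ((hasDerivAt_id c).sub_const c).fun_mul hv.differentiableAt.hasDerivAt
      simpa [k] using this
    simpa [h2.deriv] using h1.hasStrictDerivAt
  have hmap := hk.map_nhds_eq hv0
  have hkc : k c = 0 := by simp [k]
  rw [hkc] at hmap
  have hfk : ∀ᶠ z in 𝓝 c, f z - f c = k z ^ n := by
    filter_upwards [hfu] with z hz
    rw [hz, mul_pow, hvn, smul_eq_mul]
  by_cases hn1 : n = 1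
  · have : HasDerivAt f (v c) c := by
      have h1 : (fun z => k z + f c) =ᶠ[𝓝 c] f := by
        filter_upwards [hfk] with z hz
        rw [hn1, pow_one] at hz
        rw [← hz]; ring
      exact (hk.hasDerivAt.add_const (f c)).congr_of_eventuallyEq h1.symm
    rw [this.deriv]
    exact hv0
  · exfalso
    -- `k` is locally onto near `0`, so it takes both values `y` and `ξ * y`; their `n`-th powers
    -- agree, which contradicts injectivity of `f`.
    set ξ := Complex.exp (2 * Real.pi * Complex.I / n) with hξ
    have hprim := Complex.isPrimitiveRoot_exp n hn0
    have hξ1 : ξ ≠ 1 := hprim.ne_one (by omega)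
    have himg : k '' {z | z ∈ s ∧ f z - f c = k z ^ n} ∈ 𝓝 (0 : ℂ) := by
      rw [← hmap]
      exact image_mem_map (inter_mem hs hfk)
    have himg2 : ∀ᶠ y in 𝓝 (0 : ℂ), ξ * y ∈ k '' {z | z ∈ s ∧ f z - f c = k z ^ n} := by
      have : Tendsto (fun y : ℂ => ξ * y) (𝓝 0) (𝓝 0) := by
        simpa using (continuous_const_mul ξ).tendsto (0 : ℂ)
      exact this himg
    have hev : ∀ᶠ y in 𝓝[≠] (0 : ℂ), False := by
      filter_upwards [nhdsWithin_le_nhds himg, nhdsWithin_le_nhds himg2, self_mem_nhdsWithin]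
      rintro _ ⟨z, ⟨hzs, hz⟩, rfl⟩ ⟨w, ⟨hws, hw⟩, hkw⟩ hne
      have : f w = f z := by
        have : f w - f c = f z - f c := by
          rw [hw, hz, hkw, mul_pow, hprim.pow_eq_one, one_mul]
        linear_combination this
      rw [hinj hws hzs this] at hkw
      exact hξ1 (mul_right_cancel₀ hne (by rw [one_mul]; exact hkw.symm))
    exact hev.exists.elim fun _ h => h

/-- Koebe's covering theorem, with a non-optimal constant. -/
theorem norm_deriv_mul_le_of_notMem_image_ball {f : ℂ → ℂ} {r : ℝ} (hr : 0 < r)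
    (hf : DifferentiableOn ℂ f (Metric.ball 0 r)) (hinj : Set.InjOn f (Metric.ball 0 r))
    (h0 : f 0 = 0) {w : ℂ} (hw : w ∉ f '' Metric.ball 0 r) :
    ‖deriv f 0‖ * r ≤ 32 * ‖w‖ := by
  have hmem0 : (0 : ℂ) ∈ Metric.ball (0 : ℂ) r := Metric.mem_ball_self hr
  have hnhds : ∀ z ∈ Metric.ball (0 : ℂ) r, Metric.ball (0 : ℂ) r ∈ 𝓝 z :=
    fun z hz => Metric.isOpen_ball.mem_nhds hz
  have hmap : ∀ z ∈ Metric.ball (0 : ℂ) r, map f (𝓝 z) = 𝓝 (f z) := by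
    intro z hz
    have han := hf.analyticAt (hnhds z hz)
    exact han.hasStrictDerivAt.map_nhds_eq (deriv_ne_zero_of_injOn_nhds (hnhds z hz) han hinj)
  have hUo : IsOpen (f '' Metric.ball 0 r) := by
    rw [isOpen_iff_mem_nhds]
    rintro _ ⟨z, hz, rfl⟩
    rw [← hmap z hz]
    exact image_mem_map (hnhds z hz)
  -- It suffices to treat an omitted value `w₀` nearest to `0`; the image then contains the whole
  -- disk of radius `‖w₀‖`.
  obtain ⟨w₀, hw₀, hdist⟩ := hUo.isClosed_compl.exists_infDist_eq_dist ⟨w, hw⟩ 0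
  have hle : ∀ v : ℂ, v ∉ f '' Metric.ball 0 r → ‖w₀‖ ≤ ‖v‖ := by
    intro v hv
    have h1 := Metric.infDist_le_dist_of_mem (x := (0 : ℂ)) (s := (f '' Metric.ball 0 r)ᶜ) hv
    rw [hdist] at h1
    simpa using h1
  have hw₀0 : w₀ ≠ 0 := by
    rintro rfl
    exact hw₀ ⟨0, hmem0, h0⟩
  have hw₀p : 0 < ‖w₀‖ := norm_pos_iff.2 hw₀0
  have hball : ∀ v : ℂ, v ∈ Metric.ball (0 : ℂ) ‖w₀‖ → v ∈ f '' Metric.ball 0 r := by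
    intro v hv
    by_contra h
    exact absurd (hle v h) (not_le.2 (by simpa using hv))
  have hne : ∀ z ∈ Metric.ball (0 : ℂ) r, 1 - f z / w₀ ≠ 0 := by
    intro z hz h
    refine hw₀ ⟨z, hz, ?_⟩
    field_simp at h
    linear_combination -h
  have hdiff1 : DifferentiableOn ℂ (fun z => 1 - f z / w₀) (Metric.ball 0 r) :=
    (hf.div_const w₀).const_sub 1
  obtain ⟨L, hL, hL0, hLexp⟩ := exists_differentiableOn_log_ball hdiff1 hne
  simp only [h0, zero_div, sub_zero, Complex.log_one] at hL0
  -- `k` is the branch of `√(1 - f / w₀)` with value `1` at `0`.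
  let k : ℂ → ℂ := fun z => Complex.exp (L z / 2)
  have hk : DifferentiableOn ℂ k (Metric.ball 0 r) := (hL.div_const 2).cexp
  have hk0 : k 0 = 1 := by simp [k, hL0]
  have hk2 : ∀ z ∈ Metric.ball (0 : ℂ) r, k z ^ 2 = 1 - f z / w₀ := by
    intro z hz
    rw [← hLexp z hz, ← Complex.exp_nat_mul]
    congr 1
    push_cast
    ring
  let g : ℂ → ℂ := Function.invFunOn f (Metric.ball 0 r)
  have hg : ∀ v ∈ Metric.ball (0 : ℂ) ‖w₀‖, g v ∈ Metric.ball (0 : ℂ) r := fun v hv =>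
    Function.invFunOn_mem (hball v hv)
  have hfg : ∀ v ∈ Metric.ball (0 : ℂ) ‖w₀‖, f (g v) = v := fun v hv =>
    Function.invFunOn_eq (hball v hv)
  have hgf : ∀ z ∈ Metric.ball (0 : ℂ) r, g (f z) = z := fun z hz =>
    hinj.leftInvOn_invFunOn hz
  have hgc : ContinuousOn g (Metric.ball 0 ‖w₀‖) := by
    intro v hv
    refine ContinuousAt.continuousWithinAt ?_
    intro N hN
    rw [Filter.mem_map]
    have h1 : f '' (N ∩ Metric.ball 0 r) ∈ 𝓝 v := by
      have h2 := hmap _ (hg v hv)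
      rw [hfg v hv] at h2
      rw [← h2]
      exact image_mem_map (inter_mem hN (hnhds _ (hg v hv)))
    refine mem_of_superset h1 ?_
    rintro _ ⟨z, ⟨hzN, hz⟩, rfl⟩
    change g (f z) ∈ N
    rwa [hgf z hz]
  -- On the disk `‖v‖ < ‖w₀‖` the real part of `k ∘ g` is positive at `0`. It cannot vanish, since
  -- then `1 - v / w₀` would be a nonpositive real and `‖v‖ ≥ ‖w₀‖`.
  have hre : ∀ z ∈ Metric.ball (0 : ℂ) r, ‖f z‖ < ‖w₀‖ → 0 < (k z).re := by
    intro z hz hfz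
    by_contra hneg
    rw [not_lt] at hneg
    have hcont : ContinuousOn (fun v => (k (g v)).re) (Metric.ball 0 ‖w₀‖) :=
      Complex.continuous_re.comp_continuousOn (hk.continuousOn.comp hgc hg)
    have hpre := (convex_ball (0 : ℂ) ‖w₀‖).isPreconnected.image _ hcont
    have hz' : f z ∈ Metric.ball (0 : ℂ) ‖w₀‖ := by simpa using hfz
    have hg0 : g 0 = 0 := by
      have := hgf 0 hmem0
      rwa [h0] at this
    have h01 : (0 : ℝ) ∈ (fun v => (k (g v)).re) '' Metric.ball 0 ‖w₀‖ := by
      refine hpre.Icc_subset ⟨f z, hz', rfl⟩ ⟨0, Metric.mem_ball_self hw₀p, rfl⟩ ⟨?_, ?_⟩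
      · simpa [hgf z hz] using hneg
      · simp [hg0, hk0]
    obtain ⟨v, hv, hv0⟩ := h01
    simp only at hv0
    have h2 := hk2 (g v) (hg v hv)
    rw [hfg v hv] at h2
    have h3 : v = (1 + (k (g v)).im ^ 2 : ℝ) * w₀ := by
      have h4 : k (g v) = (k (g v)).im * Complex.I := by
        apply Complex.ext <;> simp [hv0]
      rw [h4, mul_pow, Complex.I_sq] at h2
      field_simp at h2
      push_cast
      linear_combination h2
    have h5 : ‖v‖ < ‖w₀‖ := by simpa using hv
    rw [h3, norm_mul, Complex.norm_real, Real.norm_of_nonneg (by positivity)] at h5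
    nlinarith [mul_nonneg (sq_nonneg (k (g v)).im) hw₀p.le]
  -- If `k z` were within `1/3` of `-1`, then `‖f z‖ ≤ (7/3)(1/3)‖w₀‖ < ‖w₀‖`, which forces a
  -- positive real part.
  have hlow : ∀ z ∈ Metric.ball (0 : ℂ) r, 1 / 3 ≤ ‖k z + 1‖ := by
    intro z hz
    by_contra hlt
    rw [not_le] at hlt
    have h1 : f z = (1 - k z) * (k z + 1) * w₀ := by
      have := hk2 z hz
      field_simp at this
      linear_combination this
    have h2 : ‖1 - k z‖ ≤ 7 / 3 := by
      calc ‖1 - k z‖ = ‖2 - (k z + 1)‖ := by ring_nf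
        _ ≤ ‖(2 : ℂ)‖ + ‖k z + 1‖ := norm_sub_le _ _
        _ ≤ 7 / 3 := by
          rw [Complex.norm_two]
          linarith
    have h3 : ‖f z‖ < ‖w₀‖ := by
      rw [h1, norm_mul, norm_mul]
      nlinarith [norm_nonneg (1 - k z), norm_nonneg (k z + 1),
        mul_le_mul h2 hlt.le (norm_nonneg _) (by norm_num)]
    have h4 := hre z hz h3
    have h5 := (Complex.abs_re_le_norm (k z + 1)).trans hlt.le
    rw [Complex.add_re, Complex.one_re, abs_le] at h5
    linarith [h5.2]
  have hk1 : ∀ z ∈ Metric.ball (0 : ℂ) r, k z + 1 ≠ 0 := by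
    intro z hz h
    have := hlow z hz
    rw [h, norm_zero] at this
    norm_num at this
  have hq : DifferentiableOn ℂ (fun z => (k z + 1)⁻¹) (Metric.ball 0 r) :=
    (hk.add_const 1).fun_inv hk1
  have hqm : Set.MapsTo (fun z => (k z + 1)⁻¹) (Metric.ball 0 r)
      (Metric.closedBall ((k 0 + 1)⁻¹) 4) := by
    intro z hz
    rw [mem_closedBall_iff_norm, hk0]
    have h1 : ‖(k z + 1)⁻¹‖ ≤ 3 := by
      rw [norm_inv]
      refine inv_le_of_inv_le₀ (by norm_num) ?_
      simpa using hlow z hz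
    have h2 : ‖((1 : ℂ) + 1)⁻¹‖ ≤ 1 := by
      rw [one_add_one_eq_two, norm_inv, Complex.norm_two]
      norm_num
    exact (norm_sub_le _ _).trans (by linarith)
  -- Cauchy's estimate gives `4 / r`; the derivative at `0` is `f'(0) / (8 w₀)`, whence the constant
  -- `32 = 4 * 8`.
  have hbound := Complex.norm_deriv_le_div_of_mapsTo_ball hq hqm hr
  have hLd : HasDerivAt L (-(deriv f 0 / w₀)) 0 := by
    have hLa := (hL.differentiableAt (hnhds 0 hmem0)).hasDerivAt
    have h1 : HasDerivAt (fun z => 1 - f z / w₀) (-(deriv f 0 / w₀)) 0 :=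
      ((hf.differentiableAt (hnhds 0 hmem0)).hasDerivAt.div_const w₀).const_sub 1
    have h2 : HasDerivAt (fun z => Complex.exp (L z)) (Complex.exp (L 0) * deriv L 0) 0 := hLa.cexp
    have h3 : (fun z => Complex.exp (L z)) =ᶠ[𝓝 0] fun z => 1 - f z / w₀ :=
      mem_of_superset (hnhds 0 hmem0) hLexp
    have h4 := h2.unique (h1.congr_of_eventuallyEq h3)
    rw [hL0, Complex.exp_zero, one_mul] at h4
    rwa [h4] at hLa
  have hqd : HasDerivAt (fun z => (k z + 1)⁻¹) (deriv f 0 / (8 * w₀)) 0 := by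
    have h1 : HasDerivAt k (Complex.exp (L 0 / 2) * (-(deriv f 0 / w₀) / 2)) 0 :=
      (hLd.div_const 2).cexp
    have h2 := (h1.add_const 1).fun_inv (hk1 0 hmem0)
    refine h2.congr_deriv ?_
    rw [hk0, hL0]
    simp
    field_simp
    norm_num
    ring
  have h8 : ‖(8 : ℂ)‖ = 8 := by simp
  rw [hqd.deriv, norm_div, norm_mul, h8, div_le_div_iff₀ (by positivity) hr] at hbound
  linarith [hle w hw]

/-! ### The derivative at infinity -/

/-- Growth estimates at infinity for an injective `g : ℂ → ℂ` that fixes `∞` and is holomorphic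
near `∞`, in terms of the derivative at `∞`. -/
theorem growth_of_injective {g : ℂ → ℂ} (hg : Function.Injective g) {R : ℝ} (hR : 0 < R)
    (hG : DifferentiableOn ℂ (fun ζ => (g ζ⁻¹ - g 0)⁻¹) (Metric.ball 0 R⁻¹)) {b : ℂ}
    (hb : deriv (fun ζ => (g ζ⁻¹ - g 0)⁻¹) 0 = b) :
    b ≠ 0 ∧ (∀ z : ℂ, ∀ S : ℝ, R ≤ S → ‖z‖ ≤ S → ‖b * (g z - g 0)‖ ≤ 32 * S) ∧
      ∀ z : ℂ, R < ‖z‖ → ‖b * (g z - g 0) / z - 1‖ ≤ 34 * R / ‖z‖ := by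
  -- With `0⁻¹ = 0` the formula itself gives `G 0 = 0`, the correct value at `∞`, and `G` is
  -- injective on all of `ℂ`.
  set G : ℂ → ℂ := fun ζ => (g ζ⁻¹ - g 0)⁻¹ with hGdef
  have hGinj : Function.Injective G := fun x y h => by
    simpa [hGdef, hg.eq_iff] using h
  have hG0 : G 0 = 0 := by simp [hGdef]
  have hRi : 0 < R⁻¹ := inv_pos.2 hR
  have hnhds : Metric.ball (0 : ℂ) R⁻¹ ∈ 𝓝 0 := Metric.ball_mem_nhds _ hRi
  have hb0 : b ≠ 0 := hb ▸
    deriv_ne_zero_of_injOn_nhds hnhds (hG.analyticAt hnhds) hGinj.injOn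
  have hii : ∀ z : ℂ, ∀ S : ℝ, R ≤ S → ‖z‖ ≤ S → ‖b * (g z - g 0)‖ ≤ 32 * S := by
    intro z S hS hz
    have hSp : 0 < S := hR.trans_le hS
    by_cases hz0 : z = 0
    · simp [hz0, hSp.le]
    have hsub : Metric.ball (0 : ℂ) S⁻¹ ⊆ Metric.ball 0 R⁻¹ :=
      Metric.ball_subset_ball (inv_anti₀ hR hS)
    -- By injectivity `G z⁻¹` is omitted on the smaller disk, so Koebe bounds it from below.
    have hnot : G z⁻¹ ∉ G '' Metric.ball 0 S⁻¹ := by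
      rintro ⟨y, hy, hyz⟩
      rw [hGinj hyz, mem_ball_zero_iff, norm_inv] at hy
      exact absurd hz (not_le.2 ((inv_lt_inv₀ (norm_pos_iff.2 hz0) hSp).1 hy))
    have h := norm_deriv_mul_le_of_notMem_image_ball (inv_pos.2 hSp) (hG.mono hsub)
      hGinj.injOn hG0 hnot
    have hne : g z - g 0 ≠ 0 := sub_ne_zero.2 (hg.ne hz0)
    have hpos := norm_pos_iff.2 hne
    rw [hb, hGdef] at h
    simp only [inv_inv, norm_inv] at h
    rw [norm_mul]
    field_simp at h
    linarith
  refine ⟨hb0, hii, fun z hz => ?_⟩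
  have hzp : 0 < ‖z‖ := hR.trans hz
  let D : ℂ → ℂ := dslope G 0
  have hD : DifferentiableOn ℂ D (Metric.ball 0 R⁻¹) :=
    (Complex.differentiableOn_dslope hnhds).2 hG
  have hD0 : D 0 = b := by simp [D, hb]
  have hDne : ∀ ζ : ℂ, ζ ≠ 0 → D ζ = G ζ / ζ := by
    intro ζ hζ
    simp only [D, dslope_of_ne _ hζ, slope_def_field, hG0, sub_zero]
  have hGne : ∀ ζ : ℂ, ζ ≠ 0 → G ζ ≠ 0 := fun ζ hζ h => hζ (hGinj (h.trans hG0.symm))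
  have hDnz : ∀ ζ ∈ Metric.ball (0 : ℂ) R⁻¹, D ζ ≠ 0 := by
    intro ζ _
    by_cases h : ζ = 0
    · rw [h, hD0]; exact hb0
    · rw [hDne ζ h]; exact div_ne_zero (hGne ζ h) h
  have hφ : DifferentiableOn ℂ (fun ζ => b / D ζ) (Metric.ball 0 R⁻¹) :=
    (differentiableOn_const b).div hD hDnz
  have hform : ∀ ζ : ℂ, ζ ≠ 0 → b / D ζ = b * (g ζ⁻¹ - g 0) / ζ⁻¹ := by
    intro ζ hζ
    rw [hDne ζ hζ, hGdef]
    simp only [div_eq_mul_inv, mul_inv, inv_inv]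
    ring
  -- In `z = 1 / ζ` this function is `b * (g z - g 0) / z`, of modulus at most `32`, with value `1`
  -- at `∞`. Its distance from `1` is at most `33`, and the Schwarz lemma turns this into decay in
  -- `1 / ‖z‖`.
  have hmaps : Set.MapsTo (fun ζ => b / D ζ) (Metric.ball 0 R⁻¹)
      (Metric.closedBall (b / D 0) 34) := by
    intro ζ hζ
    rw [hD0, div_self hb0, mem_closedBall_iff_norm]
    by_cases h : ζ = 0
    · simp [h, hD0, hb0]
    · have hζp : 0 < ‖ζ‖ := norm_pos_iff.2 h
      rw [mem_ball_zero_iff] at hζ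
      have h1 := hii ζ⁻¹ ‖ζ‖⁻¹ ((le_inv_comm₀ hR hζp).2 hζ.le) (by rw [norm_inv])
      have h2 : ‖b / D ζ‖ ≤ 32 := by
        rw [hform ζ h, norm_div, norm_inv, div_le_iff₀ (inv_pos.2 hζp)]
        exact h1
      refine (norm_sub_le _ _).trans ?_
      rw [norm_one]
      linarith
  have hz0 : z ≠ 0 := norm_pos_iff.1 hzp
  have hzm : z⁻¹ ∈ Metric.ball (0 : ℂ) R⁻¹ := by
    rw [mem_ball_zero_iff, norm_inv]
    exact (inv_lt_inv₀ hzp hR).2 hz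
  have h := Complex.dist_le_div_mul_dist_of_mapsTo_ball hφ hmaps hzm
  simp only [hD0, div_self hb0] at h
  rw [hform _ (inv_ne_zero hz0), inv_inv, dist_eq_norm, dist_zero_right, norm_inv] at h
  refine h.trans (le_of_eq ?_)
  field_simp

/-- The reciprocal of the derivative at `∞` of a map `g : ℂ → ℂ` extended by `g ∞ = ∞`, that is,
`lim z / g z` as `z → ∞`. -/
noncomputable def invDerivInfty (g : ℂ → ℂ) : ℂ := deriv (fun ζ => (g ζ⁻¹ - g 0)⁻¹) 0

/-- The derivative at `∞` of a holomorphic motion depends holomorphically on the parameter. -/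
theorem differentiableOn_invDerivInfty {F : ℂ → ℂ → ℂ} {R : ℝ} (hR : 0 < R)
    (hF : ∀ z, DifferentiableOn ℂ (fun l => F l z) (Metric.ball 0 1))
    (hinj : ∀ l ∈ Metric.ball (0 : ℂ) 1, Function.Injective (F l))
    (hG : ∀ l ∈ Metric.ball (0 : ℂ) 1,
      DifferentiableOn ℂ (fun ζ => (F l ζ⁻¹ - F l 0)⁻¹) (Metric.ball 0 R⁻¹)) :
    DifferentiableOn ℂ (fun l => invDerivInfty (F l)) (Metric.ball 0 1) := by
  -- At this modulus the error `34 * R / ‖p‖` is `1/2`, so the normalised difference at `p` is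
  -- bounded below uniformly in `l`.
  let p : ℂ := ((68 * R : ℝ) : ℂ)
  have hp : ‖p‖ = 68 * R := by
    simp only [p, Complex.norm_real, Real.norm_eq_abs]
    exact abs_of_pos (by positivity)
  have hp0 : p ≠ 0 := norm_pos_iff.1 (by rw [hp]; positivity)
  have hD : ∀ l ∈ Metric.ball (0 : ℂ) 1, F l p - F l 0 ≠ 0 := fun l hl =>
    sub_ne_zero.2 ((hinj l hl).ne hp0)
  have hgr := fun l hl => growth_of_injective (hinj l hl) hR (hG l hl) (b := invDerivInfty (F l)) rfl
  have hlow : ∀ l ∈ Metric.ball (0 : ℂ) 1,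
      34 * R ≤ ‖invDerivInfty (F l) * (F l p - F l 0)‖ := by
    intro l hl
    have h := (hgr l hl).2.2 p (by rw [hp]; linarith)
    have hq : 34 * R / ‖p‖ = 1 / 2 := by rw [hp]; field_simp; norm_num
    rw [hq] at h
    have h1 : 1 / 2 ≤ ‖invDerivInfty (F l) * (F l p - F l 0) / p‖ := by
      have := norm_sub_norm_le (1 : ℂ) (1 - invDerivInfty (F l) * (F l p - F l 0) / p)
      rw [norm_sub_rev (1 : ℂ) (invDerivInfty (F l) * (F l p - F l 0) / p), norm_one,
        sub_sub_cancel] at this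
      linarith
    rw [norm_div, le_div_iff₀ (by rw [hp]; positivity), hp] at h1
    linarith
  have hE : DifferentiableOn ℂ (fun l => (invDerivInfty (F l) * (F l p - F l 0))⁻¹)
      (Metric.ball 0 1) := by
    -- Dividing by `F l p - F l 0` removes the scale of `F l`, which is not controlled in `l`; the
    -- error becomes at most `1 / n`, uniformly on the disk.
    have hlim : TendstoUniformlyOn
        (fun (n : ℕ) l => (F l n - F l 0) / (n * (F l p - F l 0)))
        (fun l => (invDerivInfty (F l) * (F l p - F l 0))⁻¹) atTop (Metric.ball 0 1) := by
      rw [Metric.tendstoUniformlyOn_iff]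
      intro ε hε
      have hev : ∀ᶠ n : ℕ in atTop, R < n ∧ 1 / ε < n :=
        (tendsto_natCast_atTop_atTop.eventually_gt_atTop R).and
          (tendsto_natCast_atTop_atTop.eventually_gt_atTop (1 / ε))
      filter_upwards [hev] with n hn l hl
      have hnp : (0 : ℝ) < n := hR.trans hn.1
      have hn0 : (n : ℂ) ≠ 0 := by
        rw [← norm_pos_iff]
        simpa using hnp
      have hb0 := (hgr l hl).1
      have h := (hgr l hl).2.2 n (by simpa using hn.1)
      have hc : 0 < ‖invDerivInfty (F l) * (F l p - F l 0)‖ :=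
        norm_pos_iff.2 (mul_ne_zero hb0 (hD l hl))
      have heq : (F l n - F l 0) / (n * (F l p - F l 0)) -
          (invDerivInfty (F l) * (F l p - F l 0))⁻¹ =
          (invDerivInfty (F l) * (F l n - F l 0) / n - 1) /
            (invDerivInfty (F l) * (F l p - F l 0)) := by
        have := hD l hl
        field_simp
      rw [dist_comm, dist_eq_norm, heq, norm_div, div_lt_iff₀ hc]
      refine h.trans_lt ?_
      rw [Complex.norm_natCast, div_lt_iff₀ hnp]
      have h1 : 1 < n * ε := (div_lt_iff₀ hε).1 hn.2
      calc 34 * R < 34 * R * (n * ε) := lt_mul_of_one_lt_right (by positivity) h1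
        _ ≤ ‖invDerivInfty (F l) * (F l p - F l 0)‖ * (n * ε) :=
          mul_le_mul_of_nonneg_right (hlow l hl) (by positivity)
        _ = _ := by ring
    refine hlim.tendstoLocallyUniformlyOn.differentiableOn ?_ Metric.isOpen_ball
    filter_upwards [eventually_gt_atTop 0] with n hn
    refine ((hF _).sub (hF _)).div (((hF _).sub (hF _)).const_mul _) fun l hl => ?_
    exact mul_ne_zero (Nat.cast_ne_zero.2 hn.ne') (hD l hl)
  refine ((hE.fun_mul ((hF p).fun_sub (hF 0))).fun_inv fun l hl => ?_).congr fun l hl => ?_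
  · exact mul_ne_zero (inv_ne_zero (mul_ne_zero (hgr l hl).1 (hD l hl))) (hD l hl)
  · have := hD l hl
    have := (hgr l hl).1
    field_simp

/-! ### Continuity and surjectivity of the maps -/

/-- The maps of a holomorphic motion that is holomorphic near `∞` are continuous. -/
theorem continuous_of_motion {F : ℂ → ℂ → ℂ} {R : ℝ} (hR : 0 < R)
    (hF : ∀ z, DifferentiableOn ℂ (fun l => F l z) (Metric.ball 0 1))
    (hinj : ∀ l ∈ Metric.ball (0 : ℂ) 1, Function.Injective (F l))
    (hG : ∀ l ∈ Metric.ball (0 : ℂ) 1,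
      DifferentiableOn ℂ (fun ζ => (F l ζ⁻¹ - F l 0)⁻¹) (Metric.ball 0 R⁻¹))
    (hzero : ∀ z, F 0 z = z) {l : ℂ} (hl : l ∈ Metric.ball (0 : ℂ) 1) : Continuous (F l) := by
  have hgr := fun l hl => growth_of_injective (hinj l hl) hR (hG l hl) (b := invDerivInfty (F l)) rfl
  have hbd := differentiableOn_invDerivInfty hR hF hinj hG
  have hl1 : ‖l‖ < 1 := by simpa using hl
  rw [continuous_iff_continuousAt]
  intro z
  set S := max R (‖z‖ + 1) with hS
  have hSp : 0 < S := hR.trans_le (le_max_left _ _)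
  set e := (1 - ‖l‖) / (1 + ‖l‖) with he
  have hn := norm_nonneg l
  have hep : 0 < e := div_pos (by linarith) (by linarith)
  -- The factor makes the differences bounded uniformly in the parameter. For `w ≠ z` they are
  -- zero-free, so Harnack compares `l` with `0`, where the motion is the identity, with Hölder
  -- exponent `e`.
  let ψ : ℂ → ℂ → ℂ := fun w l => invDerivInfty (F l) * (F l w - F l z)
  have hψb : ∀ w, ‖w‖ ≤ S → ∀ m ∈ Metric.ball (0 : ℂ) 1, ‖ψ w m‖ ≤ 64 * S := by
    intro w hw m hm
    have h1 := (hgr m hm).2.1 w S (le_max_left _ _) hw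
    have h2 := (hgr m hm).2.1 z S (le_max_left _ _)
      ((by linarith : ‖z‖ ≤ ‖z‖ + 1).trans (le_max_right _ _))
    have h3 : ψ w m = invDerivInfty (F m) * (F m w - F m 0) -
        invDerivInfty (F m) * (F m z - F m 0) := by simp only [ψ]; ring
    rw [h3]
    refine (norm_sub_le _ _).trans ?_
    linarith
  have hest : ∀ w, ‖w‖ ≤ S → w ≠ z →
      ‖ψ w l‖ ≤ 64 * S * (‖ψ w 0‖ / (64 * S)) ^ e := by
    intro w hw hwz
    have hne : ∀ m ∈ Metric.ball (0 : ℂ) 1, ψ w m ≠ 0 := fun m hm =>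
      mul_ne_zero (hgr m hm).1 (sub_ne_zero.2 ((hinj m hm).ne hwz))
    have hH := (harnack_log_norm (φ := ψ w) (hbd.fun_mul ((hF w).fun_sub (hF z))) hne
      (hψb w hw) hl).2
    have hp0 := norm_pos_iff.2 (hne 0 (by simp))
    have hpl := norm_pos_iff.2 (hne l hl)
    have hS64 : 0 < 64 * S := by positivity
    have hH2 : e * Real.log (64 * S / ‖ψ w 0‖) ≤ Real.log (64 * S / ‖ψ w l‖) := by
      rw [he, div_mul_eq_mul_div, div_le_iff₀ (by linarith)]
      linarith
    rw [← Real.log_le_log_iff hpl (by positivity), Real.log_mul hS64.ne' (by positivity),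
      Real.log_rpow (by positivity), Real.log_div hp0.ne' hS64.ne']
    rw [Real.log_div hS64.ne' hp0.ne', Real.log_div hS64.ne' hpl.ne'] at hH2
    linarith
  have hψ0 : ∀ w, ψ w 0 = invDerivInfty (F 0) * (w - z) := fun w => by simp only [ψ, hzero]
  have hlim : Tendsto (fun w => 64 * S * (‖ψ w 0‖ / (64 * S)) ^ e) (𝓝 z) (𝓝 0) := by
    have hc : Continuous fun w => 64 * S * (‖ψ w 0‖ / (64 * S)) ^ e := by
      simp only [hψ0]
      exact continuous_const.mul (Continuous.rpow_const (by fun_prop) fun _ => Or.inr hep.le)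
    have := hc.tendsto z
    simpa [hψ0, Real.zero_rpow hep.ne'] using this
  have hψlim : Tendsto (fun w => ψ w l) (𝓝 z) (𝓝 0) := by
    refine squeeze_zero_norm' ?_ hlim
    have hball : ∀ᶠ w in 𝓝 z, w ∈ Metric.ball z 1 := Metric.ball_mem_nhds z one_pos
    filter_upwards [hball] with w hw
    by_cases hwz : w = z
    · rw [hwz]
      simp only [ψ, sub_self, mul_zero, norm_zero]
      positivity
    · refine hest w ?_ hwz
      rw [mem_ball_iff_norm] at hw
      have := norm_sub_norm_le w z
      exact (by linarith : ‖w‖ ≤ ‖z‖ + 1).trans (le_max_right _ _)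
  have h := (hψlim.const_mul (invDerivInfty (F l))⁻¹).add_const (F l z)
  rw [mul_zero, zero_add] at h
  refine h.congr fun w => ?_
  simp only [ψ]
  rw [inv_mul_cancel_left₀ (hgr l hl).1, sub_add_cancel]

/-- A continuous map of the plane that behaves like `c z` at infinity, with `c ≠ 0`, is onto. -/
theorem surjective_of_tendsto_div {g : ℂ → ℂ} (hg : Continuous g) {c : ℂ} (hc : c ≠ 0)
    (hlim : Tendsto (fun z => g z / z) (cobounded ℂ) (𝓝 c)) : Function.Surjective g := by
  intro w
  by_contra hw
  push Not at hw
  -- If `w` is omitted, `g - w` has a global continuous logarithm, so its winding number on circles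
  -- is `0`; on large circles it is also that of `c * z`, namely `1`.
  obtain ⟨L, ⟨-, hL⟩, -⟩ := Complex.isCoveringMapOn_exp.existsUnique_continuousMap_lifts
    (⟨fun z => g z - w, by fun_prop⟩ : C(ℂ, ℂ)) (a₀ := 0) (e₀ := Complex.log (g 0 - w))
    (Complex.exp_log (sub_ne_zero.2 (hw 0))) (fun z => sub_ne_zero.2 (hw z))
  have hLe : ∀ z, Complex.exp (L z) = g z - w := fun z => congrFun hL z
  have hlim2 : Tendsto (fun z => (g z - w) / (c * z)) (cobounded ℂ) (𝓝 1) := by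
    have h1 : Tendsto (fun z : ℂ => w / z) (cobounded ℂ) (𝓝 0) := by
      simpa [div_eq_mul_inv] using (tendsto_inv₀_cobounded (α := ℂ)).const_mul w
    have h2 := (hlim.sub h1).div_const c
    rw [sub_zero, div_self hc] at h2
    refine h2.congr fun z => ?_
    rw [← sub_div, div_div, mul_comm z]
  have hev : ∀ᶠ z in cobounded ℂ, (g z - w) / (c * z) ∈ Complex.slitPlane :=
    hlim2.eventually (Complex.isOpen_slitPlane.mem_nhds Complex.one_mem_slitPlane)
  obtain ⟨r, -, hr⟩ := (hasBasis_cobounded_norm (E := ℂ)).eventually_iff.1 hev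
  set ρ := max r 1 with hρ
  have hρp : 0 < ρ := zero_lt_one.trans_le (le_max_right _ _)
  let γ : ℝ → ℂ := fun t => ρ * Complex.exp (t * Complex.I)
  have hγn : ∀ t, ‖γ t‖ = ρ := fun t => by
    simp [γ, Complex.norm_exp_ofReal_mul_I, abs_of_pos hρp]
  have hγ0 : ∀ t, γ t ≠ 0 := fun t => norm_pos_iff.1 (by rw [hγn]; exact hρp)
  have hγs : ∀ t, (g (γ t) - w) / (c * γ t) ∈ Complex.slitPlane := fun t =>
    hr (by simp [hγn, hρ])
  have hγc : Continuous γ := by fun_prop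
  have hγper : γ (2 * Real.pi) = γ 0 := by simp [γ]
  -- `θ` is the difference of two logarithms of `g - w` along the circle, hence a constant in
  -- `2πiℤ`; yet the term `t * I` changes it by `2πi` over one turn.
  let θ : ℝ → ℂ := fun t => L (γ t) - Complex.log ((g (γ t) - w) / (c * γ t)) -
    Complex.log (c * ρ) - t * Complex.I
  have hθc : Continuous θ := by
    have h1 : Continuous fun t => Complex.log ((g (γ t) - w) / (c * γ t)) :=
      Continuous.clog (((hg.comp hγc).sub continuous_const).div (hγc.const_mul c)
        fun t => mul_ne_zero hc (hγ0 t)) hγs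
    have h2 : Continuous fun t => L (γ t) := L.continuous.comp hγc
    fun_prop
  have hθexp : ∀ t, Complex.exp (θ t) = 1 := by
    intro t
    have hne : g (γ t) - w ≠ 0 := sub_ne_zero.2 (hw _)
    have hρ0 : (ρ : ℂ) ≠ 0 := Complex.ofReal_ne_zero.2 hρp.ne'
    simp only [θ, Complex.exp_sub, hLe]
    rw [Complex.exp_log (Complex.slitPlane_ne_zero (hγs t)), Complex.exp_log (mul_ne_zero hc hρ0)]
    have he := Complex.exp_ne_zero (t * Complex.I)
    simp only [γ] at hne ⊢
    field_simp
  have hint : ∀ t, ∃ n : ℤ, ((θ t).im / (2 * Real.pi)) = n := by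
    intro t
    obtain ⟨n, hn⟩ := Complex.exp_eq_one_iff.1 (hθexp t)
    refine ⟨n, ?_⟩
    rw [hn]
    simp
  have hconst : ∀ s t : ℝ, (θ s).im / (2 * Real.pi) = (θ t).im / (2 * Real.pi) := by
    choose N hN using hint
    have hNc : Continuous N := by
      rw [Int.isClosedEmbedding_coe_real.isInducing.continuous_iff]
      refine Continuous.congr (f := fun t => (θ t).im / (2 * Real.pi)) (by fun_prop) hN
    intro s t
    rw [hN s, hN t, PreconnectedSpace.constant inferInstance hNc]
  have h1 := hconst 0 (2 * Real.pi)
  simp only [θ, hγper] at h1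
  have hpi := Real.pi_pos
  simp at h1
  field_simp at h1
  linarith

/-! ### Holomorphic inverses and charts of the sphere -/

/-- The inverse of a homeomorphism of Riemann surfaces is holomorphic where the homeomorphism is. -/
theorem Homeomorph.mdifferentiableAt_symm {M N : Type*} [TopologicalSpace M] [ChartedSpace ℂ M]
    [IsManifold 𝓘(ℂ) 1 M] [TopologicalSpace N] [ChartedSpace ℂ N] [IsManifold 𝓘(ℂ) 1 N]
    (Φ : M ≃ₜ N) {p : M} (h : ∀ᶠ q in 𝓝 p, MDifferentiableAt 𝓘(ℂ) 𝓘(ℂ) Φ q) :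
    MDifferentiableAt 𝓘(ℂ) 𝓘(ℂ) Φ.symm (Φ p) := by
  set e := chartAt ℂ p with he
  set e' := chartAt ℂ (Φ p) with he'
  have hp : p ∈ e.source := mem_chart_source ℂ p
  have hp' : Φ p ∈ e'.source := mem_chart_source ℂ (Φ p)
  have heq : e.symm (e p) = p := e.left_inv hp
  have hsymm : Tendsto e.symm (𝓝 (e p)) (𝓝 p) := e.tendsto_symm hp
  have hs : ∀ᶠ x in 𝓝 (e p), x ∈ e.target ∧ Φ (e.symm x) ∈ e'.source ∧
      MDifferentiableAt 𝓘(ℂ) 𝓘(ℂ) Φ (e.symm x) := by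
    have h1 : ∀ᶠ q in 𝓝 p, Φ q ∈ e'.source :=
      Φ.continuous.continuousAt.eventually (e'.open_source.mem_nhds hp')
    filter_upwards [e.open_target.mem_nhds (e.map_source hp), hsymm.eventually h1,
      hsymm.eventually h] with x hx hx' hx''
    exact ⟨hx, hx', hx''⟩
  have hdiff : ∀ᶠ x in 𝓝 (e p), DifferentiableAt ℂ (fun x => e' (Φ (e.symm x))) x := by
    filter_upwards [hs] with x hx
    rw [← mdifferentiableAt_iff_differentiableAt]
    have h1 : MDifferentiableAt 𝓘(ℂ) 𝓘(ℂ) e.symm x :=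
      mdifferentiableAt_atlas_symm (chart_mem_atlas ℂ p) hx.1
    have h2 : MDifferentiableAt 𝓘(ℂ) 𝓘(ℂ) e' (Φ (e.symm x)) :=
      mdifferentiableAt_atlas (chart_mem_atlas ℂ (Φ p)) hx.2.1
    exact (h2.comp _ hx.2.2).comp x h1
  have han : AnalyticAt ℂ (fun x => e' (Φ (e.symm x))) (e p) :=
    Complex.analyticAt_iff_eventually_differentiableAt.2 hdiff
  have hinj : Set.InjOn (fun x => e' (Φ (e.symm x)))
      {x | x ∈ e.target ∧ Φ (e.symm x) ∈ e'.source} := by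
    rintro x ⟨hx, hx'⟩ y ⟨hy, hy'⟩ hxy
    exact e.symm.injOn hx hy (Φ.injective (e'.injOn hx' hy' hxy))
  -- Injectivity supplies the nonzero derivative; with continuity of the inverse, this makes the
  -- inverse differentiable in charts.
  have hd := deriv_ne_zero_of_injOn_nhds (hs.mono fun x hx => ⟨hx.1, hx.2.1⟩) han hinj
  let k : ℂ → ℂ := fun y => e (Φ.symm (e'.symm y))
  have heq' : e'.symm (e' (Φ p)) = Φ p := e'.left_inv hp'
  have hkp : k (e' (Φ p)) = e p := by simp only [k, heq', Φ.symm_apply_apply]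
  have hsymm' : Tendsto (fun y => Φ.symm (e'.symm y)) (𝓝 (e' (Φ p))) (𝓝 p) := by
    have h1 := Φ.symm.continuous.tendsto (Φ p)
    rw [Φ.symm_apply_apply] at h1
    exact h1.comp (e'.tendsto_symm hp')
  have hkc : ContinuousAt k (e' (Φ p)) := by
    rw [ContinuousAt, hkp]
    exact (e.continuousAt hp).tendsto.comp hsymm'
  have hinv : ∀ᶠ y in 𝓝 (e' (Φ p)), e' (Φ (e.symm (k y))) = y := by
    filter_upwards [hsymm'.eventually (e.open_source.mem_nhds hp),
      e'.open_target.mem_nhds (e'.map_source hp')] with y hy hy'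
    simp only [k]
    rw [e.left_inv hy, Φ.apply_symm_apply, e'.right_inv hy']
  have hkd : HasDerivAt k _ (e' (Φ p)) := HasDerivAt.of_local_left_inverse hkc
    (by rw [hkp]; exact han.differentiableAt.hasDerivAt) hd hinv
  have hkm : MDifferentiableAt 𝓘(ℂ) 𝓘(ℂ) k (e' (Φ p)) :=
    hkd.differentiableAt.mdifferentiableAt
  have hcomp : MDifferentiableAt 𝓘(ℂ) 𝓘(ℂ) (fun q => e.symm (k (e' q))) (Φ p) := by
    have h1 : MDifferentiableAt 𝓘(ℂ) 𝓘(ℂ) e' (Φ p) :=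
      mdifferentiableAt_atlas (chart_mem_atlas ℂ (Φ p)) hp'
    have h2 : MDifferentiableAt 𝓘(ℂ) 𝓘(ℂ) e.symm (k (e' (Φ p))) :=
      mdifferentiableAt_atlas_symm (chart_mem_atlas ℂ p) (by rw [hkp]; exact e.map_source hp)
    exact (h2.comp _ hkm).comp _ h1
  refine hcomp.congr_of_eventuallyEq ?_
  have hlim : Tendsto Φ.symm (𝓝 (Φ p)) (𝓝 p) := by
    simpa using Φ.symm.continuous.tendsto (Φ p)
  filter_upwards [e'.open_source.mem_nhds hp', hlim.eventually (e.open_source.mem_nhds hp)]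
    with q hq hq'
  simp only [k]
  rw [e'.left_inv hq, e.left_inv hq']

namespace RiemannSphere

instance : IsManifold 𝓘(ℂ) 1 RiemannSphere :=
  IsManifold.of_le (n := ω) le_top

theorem mdifferentiableAt_chartFinite (z : ℂ) :
    MDifferentiableAt 𝓘(ℂ) 𝓘(ℂ) chartFinite (z : RiemannSphere) :=
  mdifferentiableAt_atlas (by exact Or.inl rfl) (OnePoint.coe_ne_infty z)

theorem mdifferentiableAt_coe (z : ℂ) :
    MDifferentiableAt 𝓘(ℂ) 𝓘(ℂ) (fun z : ℂ => (z : RiemannSphere)) z :=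
  mdifferentiableAt_atlas_symm (e := chartFinite) (by exact Or.inl rfl) (Set.mem_univ z)

theorem mdifferentiableAt_chartInfty :
    MDifferentiableAt 𝓘(ℂ) 𝓘(ℂ) chartInfty (OnePoint.infty : RiemannSphere) :=
  mdifferentiableAt_atlas (by exact Or.inr rfl) (OnePoint.infty_ne_coe 0)

theorem mdifferentiableAt_chartInfty_symm (ζ : ℂ) :
    MDifferentiableAt 𝓘(ℂ) 𝓘(ℂ) chartInfty.symm ζ :=
  mdifferentiableAt_atlas_symm (by exact Or.inr rfl) (Set.mem_univ ζ)

theorem chartInfty_symm_zero : chartInfty.symm 0 = OnePoint.infty :=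
  if_pos rfl

theorem chartInfty_symm_of_ne {ζ : ℂ} (hζ : ζ ≠ 0) :
    chartInfty.symm ζ = ((ζ⁻¹ : ℂ) : RiemannSphere) :=
  if_neg hζ

theorem coe_chartFinite {p : RiemannSphere} (hp : p ≠ OnePoint.infty) :
    ((chartFinite p : ℂ) : RiemannSphere) = p :=
  chartFinite.left_inv hp

end RiemannSphere

theorem coe_mem_sphereCompl {K : Set ℂ} {z : ℂ} : (z : RiemannSphere) ∈ sphereCompl K ↔ z ∉ K := by
  simp [sphereCompl]

theorem infty_mem_sphereCompl (K : Set ℂ) : (OnePoint.infty : RiemannSphere) ∈ sphereCompl K := by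
  simp [sphereCompl]

theorem isOpen_sphereCompl {K : Set ℂ} (hK : IsCompact K) : IsOpen (sphereCompl K) :=
  (hK.image OnePoint.continuous_coe).isClosed.isOpen_compl

/-! ### Conformal change of analytic capacity -/

/-- The set of the numbers `|g'(∞)|` of which the analytic capacity is the supremum. -/
def derivInftyNorms (K : Set ℂ) : Set ℝ :=
  {r : ℝ | ∃ (g : RiemannSphere → ℂ) (d : ℂ),
    MDifferentiableOn 𝓘(ℂ) 𝓘(ℂ) g (sphereCompl K) ∧
    (∀ p ∈ sphereCompl K, ‖g p‖ < 1) ∧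
    Tendsto (fun z : ℂ => z * (g (z : RiemannSphere) - g OnePoint.infty)) (cobounded ℂ) (𝓝 d) ∧
    r = ‖d‖}

/-- Pulling back by a holomorphic map with derivative `a` at `∞` multiplies `|g'(∞)|` by
`|a|⁻¹`. -/
theorem mul_inv_mem_derivInftyNorms {K K' : Set ℂ} {Φ : RiemannSphere → RiemannSphere} {φ : ℂ → ℂ}
    (hφ : ∀ z : ℂ, Φ z = φ z) (hinf : Φ OnePoint.infty = OnePoint.infty)
    (hΦ : MDifferentiableOn 𝓘(ℂ) 𝓘(ℂ) Φ (sphereCompl K))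
    (hmaps : Set.MapsTo Φ (sphereCompl K) (sphereCompl K')) {a : ℂ} (ha : a ≠ 0)
    (hlim : Tendsto (fun z => φ z / z) (cobounded ℂ) (𝓝 a)) {r : ℝ} (hr : r ∈ derivInftyNorms K') :
    r * ‖a‖⁻¹ ∈ derivInftyNorms K := by
  obtain ⟨g, d, hg, hg1, hd, rfl⟩ := hr
  refine ⟨g ∘ Φ, d * a⁻¹, hg.comp hΦ hmaps, fun p hp => hg1 _ (hmaps hp), ?_,
    by rw [norm_mul, norm_inv]⟩
  have hne : ∀ᶠ z : ℂ in cobounded ℂ, z ≠ 0 := eventually_ne_cobounded 0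
  have hcob : Tendsto φ (cobounded ℂ) (cobounded ℂ) := by
    rw [← tendsto_norm_atTop_iff_cobounded]
    have h1 := tendsto_norm_cobounded_atTop.atTop_mul_pos (norm_pos_iff.2 ha) hlim.norm
    refine h1.congr' ?_
    filter_upwards [hne] with z hz
    rw [← norm_mul, mul_div_cancel₀ _ hz]
  -- Write `z` as `φ z` times `z / φ z`.
  have h2 := (hd.comp hcob).mul (hlim.inv₀ ha)
  have hne' : ∀ᶠ z : ℂ in cobounded ℂ, φ z ≠ 0 := hcob.eventually (eventually_ne_cobounded 0)
  refine h2.congr' ?_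
  filter_upwards [hne, hne'] with z hz hz'
  simp only [Function.comp_apply, hφ, hinf, inv_div]
  field_simp

open scoped Pointwise in
/-- A conformal homeomorphism with derivative `a` at `∞` multiplies analytic capacity by `|a|`. -/
theorem analyticCapacity_eq_norm_mul {K K' : Set ℂ} (hK : IsCompact K)
    (Φ : RiemannSphere ≃ₜ RiemannSphere) {φ : ℂ → ℂ} (hφ : ∀ z : ℂ, Φ z = φ z)
    (hinf : Φ OnePoint.infty = OnePoint.infty)
    (hΦ : MDifferentiableOn 𝓘(ℂ) 𝓘(ℂ) Φ (sphereCompl K)) (himg : φ '' K = K') {a : ℂ} (ha : a ≠ 0)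
    (hlim : Tendsto (fun z => φ z / z) (cobounded ℂ) (𝓝 a)) :
    analyticCapacity K' = ‖a‖ * analyticCapacity K := by
  have hopen := isOpen_sphereCompl hK
  have hinf' : Φ.symm OnePoint.infty = OnePoint.infty := by
    rw [Φ.symm_apply_eq, hinf]
  have hφinj : Function.Injective φ := fun x y h =>
    OnePoint.coe_injective (Φ.injective (by rw [hφ, hφ, h]))
  let χ : ℂ → ℂ := fun w => RiemannSphere.chartFinite (Φ.symm w)
  have hχ : ∀ w : ℂ, Φ.symm w = χ w := fun w => by
    refine (RiemannSphere.coe_chartFinite fun h => ?_).symm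
    rw [Φ.symm_apply_eq, hinf] at h
    exact OnePoint.coe_ne_infty w h
  have hφχ : ∀ w, φ (χ w) = w := fun w => by
    apply OnePoint.coe_injective
    rw [← hφ, ← hχ, Φ.apply_symm_apply]
  have hmem : ∀ p, Φ p ∈ sphereCompl K' ↔ p ∈ sphereCompl K := by
    intro p
    induction p using OnePoint.rec with
    | infty => rw [hinf]; simp [infty_mem_sphereCompl]
    | coe z =>
      rw [hφ, coe_mem_sphereCompl, coe_mem_sphereCompl, ← himg, hφinj.mem_set_image]
  have hsymm : MDifferentiableOn 𝓘(ℂ) 𝓘(ℂ) Φ.symm (sphereCompl K') := by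
    intro q hq
    obtain ⟨p, rfl⟩ := Φ.surjective q
    have hp := (hmem p).1 hq
    refine (Φ.mdifferentiableAt_symm ?_).mdifferentiableWithinAt
    filter_upwards [hopen.mem_nhds hp] with y hy
    exact hΦ.mdifferentiableAt (hopen.mem_nhds hy)
  have hmaps' : Set.MapsTo Φ.symm (sphereCompl K') (sphereCompl K) := fun q hq => by
    rw [← hmem, Φ.apply_symm_apply]
    exact hq
  have hχcob : Tendsto χ (cobounded ℂ) (cobounded ℂ) := by
    have h1 : Tendsto (fun w : ℂ => ((χ w : ℂ) : RiemannSphere)) (cobounded ℂ)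
        (𝓝 OnePoint.infty) := by
      have h2 : Tendsto (fun w : ℂ => (w : RiemannSphere)) (cobounded ℂ) (𝓝 OnePoint.infty) := by
        have := OnePoint.tendsto_coe_infty (X := ℂ)
        rwa [coclosedCompact_eq_cocompact, ← Metric.cobounded_eq_cocompact] at this
      have h3 := (Φ.symm.continuous.tendsto OnePoint.infty).comp h2
      rw [hinf'] at h3
      exact h3.congr fun w => hχ w
    have h4 : comap (fun w : ℂ => (w : RiemannSphere)) (𝓝 OnePoint.infty) = cobounded ℂ := by
      rw [OnePoint.comap_coe_nhds_infty, coclosedCompact_eq_cocompact,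
        ← Metric.cobounded_eq_cocompact]
    rw [← h4, tendsto_comap_iff, h4]
    exact h1
  have hlim' : Tendsto (fun w => χ w / w) (cobounded ℂ) (𝓝 a⁻¹) := by
    refine ((hlim.comp hχcob).inv₀ ha).congr fun w => ?_
    simp only [Function.comp_apply, hφχ, inv_div]
  -- Pulling back by `Φ` gives one inclusion, and by its inverse, with derivative `a⁻¹` at `∞`, the
  -- other.
  have hset : derivInftyNorms K' = ‖a‖ • derivInftyNorms K := by
    have hna : ‖a‖ ≠ 0 := norm_ne_zero_iff.2 ha
    ext r
    rw [Set.mem_smul_set_iff_inv_smul_mem₀ hna, smul_eq_mul]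
    constructor
    · intro hr
      rw [mul_comm]
      exact mul_inv_mem_derivInftyNorms hφ hinf hΦ (fun p hp => (hmem p).2 hp) ha hlim hr
    · intro hr
      have h := mul_inv_mem_derivInftyNorms hχ hinf' hsymm hmaps' (inv_ne_zero ha) hlim' hr
      rwa [norm_inv, inv_inv, mul_comm, mul_inv_cancel_left₀ hna] at h
  change sSup (derivInftyNorms K') = ‖a‖ * sSup (derivInftyNorms K)
  -- The real `sSup` commutes with this scaling for every set, so boundedness of the competitors is
  -- not needed.
  rw [hset, Real.sSup_smul_of_nonneg (norm_nonneg a), smul_eq_mul]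

/-! ### From the sphere to the plane coordinate -/

/-- An injective self-map of the sphere that fixes `∞` and is holomorphic off the disk of radius
`R` is holomorphic near `∞` in the coordinate `1 / z`, after a translation. -/
theorem differentiableOn_inv_sub_inv {K : Set ℂ} (hK : IsCompact K) {R : ℝ} (hR : 0 < R)
    (hKR : K ⊆ Metric.closedBall 0 R) {Φ : RiemannSphere → RiemannSphere} {φ : ℂ → ℂ}
    (hφ : ∀ z : ℂ, Φ z = φ z) (hinj : Function.Injective φ)
    (hinf : Φ OnePoint.infty = OnePoint.infty)
    (hΦ : MDifferentiableOn 𝓘(ℂ) 𝓘(ℂ) Φ (sphereCompl K)) :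
    DifferentiableOn ℂ (fun ζ => (φ ζ⁻¹ - φ 0)⁻¹) (Metric.ball 0 R⁻¹) := by
  have hopen := isOpen_sphereCompl hK
  intro ζ hζ
  refine DifferentiableAt.differentiableWithinAt ?_
  by_cases hζ0 : ζ = 0
  · subst hζ0
    let H : ℂ → ℂ := fun ζ => RiemannSphere.chartInfty (Φ (RiemannSphere.chartInfty.symm ζ))
    have hΦinf : MDifferentiableAt 𝓘(ℂ) 𝓘(ℂ) Φ OnePoint.infty :=
      hΦ.mdifferentiableAt (hopen.mem_nhds (infty_mem_sphereCompl K))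
    have hs0 := RiemannSphere.chartInfty_symm_zero
    have hinner : MDifferentiableAt 𝓘(ℂ) 𝓘(ℂ) (fun ζ => Φ (RiemannSphere.chartInfty.symm ζ)) 0 := by
      refine MDifferentiableAt.comp (0 : ℂ) ?_ (RiemannSphere.mdifferentiableAt_chartInfty_symm 0)
      rwa [hs0]
    have hH : DifferentiableAt ℂ H 0 := by
      rw [← mdifferentiableAt_iff_differentiableAt]
      refine MDifferentiableAt.comp (0 : ℂ) ?_ hinner
      rw [hs0, hinf]
      exact RiemannSphere.mdifferentiableAt_chartInfty
    have hH0 : H 0 = 0 := by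
      simp only [H, hs0, hinf]
      rfl
    -- `H` is `1 / φ(1/ζ)`, and `1 / (x - φ 0)` is a Möbius function of `1 / x`.
    have hdiff : DifferentiableAt ℂ (fun ζ => H ζ / (1 - φ 0 * H ζ)) 0 :=
      hH.fun_div ((hH.const_mul _).const_sub 1) (by simp [hH0])
    refine hdiff.congr_of_eventuallyEq ?_
    have hev : ∀ᶠ ζ in 𝓝 (0 : ℂ), Φ (RiemannSphere.chartInfty.symm ζ) ≠ ((0 : ℂ) : RiemannSphere) := by
      refine hinner.continuousAt.eventually_ne ?_
      rw [hs0, hinf]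
      exact OnePoint.infty_ne_coe 0
    filter_upwards [hev] with ζ hζ
    by_cases h0 : ζ = 0
    · simp [h0, hH0]
    · rw [RiemannSphere.chartInfty_symm_of_ne h0, hφ] at hζ
      have hne : φ ζ⁻¹ ≠ 0 := fun h => hζ (by rw [h])
      have hHζ : H ζ = (φ ζ⁻¹)⁻¹ := by
        simp only [H]
        rw [RiemannSphere.chartInfty_symm_of_ne h0, hφ]
        rfl
      have hsub : φ ζ⁻¹ - φ 0 ≠ 0 := sub_ne_zero.2 (hinj.ne (inv_ne_zero h0))
      rw [hHζ]
      generalize φ ζ⁻¹ = x at hne hsub ⊢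
      have hx : 1 - φ 0 * x⁻¹ = (x - φ 0) * x⁻¹ := by field_simp
      rw [hx]
      field_simp
  · have hmem : ζ⁻¹ ∉ K := by
      intro h
      have h1 := hKR h
      rw [mem_closedBall_zero_iff, norm_inv] at h1
      rw [mem_ball_zero_iff] at hζ
      exact absurd h1 (not_le.2 ((lt_inv_comm₀ hR (norm_pos_iff.2 hζ0)).2 hζ))
    have hd : DifferentiableAt ℂ φ ζ⁻¹ := by
      rw [← mdifferentiableAt_iff_differentiableAt]
      have h1 : MDifferentiableAt 𝓘(ℂ) 𝓘(ℂ)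
          (fun z : ℂ => RiemannSphere.chartFinite (Φ (z : RiemannSphere))) ζ⁻¹ := by
        refine MDifferentiableAt.comp (ζ⁻¹ : ℂ) (g := fun p => RiemannSphere.chartFinite (Φ p)) ?_
          (RiemannSphere.mdifferentiableAt_coe _)
        refine MDifferentiableAt.comp _ ?_
          (hΦ.mdifferentiableAt (hopen.mem_nhds (coe_mem_sphereCompl.2 hmem)))
        rw [hφ]
        exact RiemannSphere.mdifferentiableAt_chartFinite _
      refine h1.congr_of_eventuallyEq (Eventually.of_forall fun z => ?_)
      simp only [hφ]
      rfl
    have hsub : φ ζ⁻¹ - φ 0 ≠ 0 := sub_ne_zero.2 (hinj.ne (inv_ne_zero hζ0))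
    exact ((hd.comp ζ (differentiableAt_inv hζ0)).sub_const (φ 0)).fun_inv hsub

/-- The derivative at `∞` is the limit of `g z / z`. -/
theorem tendsto_div_invDerivInfty {g : ℂ → ℂ} (hg : Function.Injective g) {R : ℝ} (hR : 0 < R)
    (hG : DifferentiableOn ℂ (fun ζ => (g ζ⁻¹ - g 0)⁻¹) (Metric.ball 0 R⁻¹)) :
    Tendsto (fun z => g z / z) (cobounded ℂ) (𝓝 (invDerivInfty g)⁻¹) := by
  obtain ⟨hb0, -, h⟩ := growth_of_injective hg hR hG (b := invDerivInfty g) rfl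
  have h1 : Tendsto (fun z => invDerivInfty g * (g z - g 0) / z - 1) (cobounded ℂ) (𝓝 0) := by
    have h2 : Tendsto (fun z : ℂ => 34 * R / ‖z‖) (cobounded ℂ) (𝓝 0) :=
      tendsto_norm_cobounded_atTop.const_div_atTop _
    refine squeeze_zero_norm' ?_ h2
    filter_upwards [tendsto_norm_cobounded_atTop.eventually_gt_atTop R] with z hz
    exact h z hz
  have h3 : Tendsto (fun z : ℂ => g 0 / z) (cobounded ℂ) (𝓝 0) := by
    simpa [div_eq_mul_inv] using (tendsto_inv₀_cobounded (α := ℂ)).const_mul (g 0)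
  have h4 := ((h1.add_const 1).const_mul (invDerivInfty g)⁻¹).add h3
  rw [zero_add, mul_one, add_zero] at h4
  refine h4.congr fun z => ?_
  rw [sub_add_cancel, mul_div_assoc, inv_mul_cancel_left₀ hb0, ← add_div, sub_add_cancel]

/-! ### The main theorem -/

theorem mainTheorem2 (K : Set ℂ) (hK : IsCompact K) (hγ : 0 < analyticCapacity K)
    (f : ℂ → RiemannSphere → RiemannSphere)
    (hf : IsHolomorphicMotion Set.univ f)
    (hhol : ∀ lam ∈ Metric.ball (0 : ℂ) 1,
      MDifferentiableOn 𝓘(ℂ) 𝓘(ℂ) (f lam) (sphereCompl K))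
    (hinf : ∀ lam ∈ Metric.ball (0 : ℂ) 1, f lam OnePoint.infty = OnePoint.infty)
    (M : ℝ)
    (hM : ∀ lam ∈ Metric.ball (0 : ℂ) 1, analyticCapacity (movedSet f K lam) ≤ M) :
    ∀ lam ∈ Metric.ball (0 : ℂ) 1,
      IsCompact (movedSet f K lam) ∧
      0 < analyticCapacity (movedSet f K lam) ∧
      (analyticCapacity K < M →
        (1 - ‖lam‖) / (1 + ‖lam‖) ≤
            Real.log (M / analyticCapacity (movedSet f K lam)) /
              Real.log (M / analyticCapacity K) ∧
        Real.log (M / analyticCapacity (movedSet f K lam)) /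
              Real.log (M / analyticCapacity K) ≤
            (1 + ‖lam‖) / (1 - ‖lam‖)) ∧
      (analyticCapacity K = M → analyticCapacity (movedSet f K lam) = M) := by
  obtain ⟨R, hR, hKR⟩ : ∃ R : ℝ, 0 < R ∧ K ⊆ Metric.closedBall 0 R := by
    obtain ⟨R, hR⟩ := hK.isBounded.subset_closedBall 0
    exact ⟨max R 1, zero_lt_one.trans_le (le_max_right _ _),
      hR.trans (Metric.closedBall_subset_closedBall (le_max_left _ _))⟩
  have h0mem : (0 : ℂ) ∈ Metric.ball (0 : ℂ) 1 := by simp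
  have hfinj : ∀ l ∈ Metric.ball (0 : ℂ) 1, Function.Injective (f l) := fun l hl =>
    Set.injOn_univ.1 (hf.injOn l hl)
  let F : ℂ → ℂ → ℂ := fun l z => RiemannSphere.chartFinite (f l z)
  have hfin : ∀ l ∈ Metric.ball (0 : ℂ) 1, ∀ z : ℂ, f l z ≠ OnePoint.infty := by
    intro l hl z h
    rw [← hinf l hl] at h
    exact OnePoint.coe_ne_infty z (hfinj l hl h)
  have hFf : ∀ l ∈ Metric.ball (0 : ℂ) 1, ∀ z : ℂ, f l z = F l z := fun l hl z =>
    (RiemannSphere.coe_chartFinite (hfin l hl z)).symm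
  have hFd : ∀ z, DifferentiableOn ℂ (fun l => F l z) (Metric.ball 0 1) := by
    intro z l hl
    have h1 : MDifferentiableAt 𝓘(ℂ) 𝓘(ℂ) (fun l => f l z) l :=
      (hf.holomorphic z (Set.mem_univ _)).mdifferentiableAt (Metric.isOpen_ball.mem_nhds hl)
    have h2 : MDifferentiableAt 𝓘(ℂ) 𝓘(ℂ) (fun l => F l z) l := by
      refine MDifferentiableAt.comp l ?_ h1
      rw [hFf l hl]
      exact RiemannSphere.mdifferentiableAt_chartFinite _
    exact (mdifferentiableAt_iff_differentiableAt.1 h2).differentiableWithinAt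
  have hFinj : ∀ l ∈ Metric.ball (0 : ℂ) 1, Function.Injective (F l) := fun l hl x y h =>
    OnePoint.coe_injective (hfinj l hl (by rw [hFf l hl, hFf l hl, h]))
  have hF0 : ∀ z, F 0 z = z := fun z => by
    simp only [F, hf.map_zero z (Set.mem_univ _)]
    rfl
  have hG : ∀ l ∈ Metric.ball (0 : ℂ) 1,
      DifferentiableOn ℂ (fun ζ => (F l ζ⁻¹ - F l 0)⁻¹) (Metric.ball 0 R⁻¹) := fun l hl =>
    differentiableOn_inv_sub_inv hK hR hKR (hFf l hl) (hFinj l hl) (hinf l hl) (hhol l hl)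
  have hb0 : ∀ l ∈ Metric.ball (0 : ℂ) 1, invDerivInfty (F l) ≠ 0 := fun l hl =>
    (growth_of_injective (hFinj l hl) hR (hG l hl) rfl).1
  have hFc : ∀ l ∈ Metric.ball (0 : ℂ) 1, Continuous (F l) := fun l hl =>
    continuous_of_motion hR hFd hFinj hG hF0 hl
  have hmoved : ∀ l ∈ Metric.ball (0 : ℂ) 1, F l '' K = movedSet f K l := by
    intro l hl
    ext w
    simp only [movedSet, Set.mem_image, Set.mem_ofPred_eq, hFf l hl, OnePoint.coe_eq_coe]
  have hcap : ∀ l ∈ Metric.ball (0 : ℂ) 1, analyticCapacity (movedSet f K l) =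
      ‖(invDerivInfty (F l))⁻¹‖ * analyticCapacity K := by
    intro l hl
    have hlim := tendsto_div_invDerivInfty (hFinj l hl) hR (hG l hl)
    have hane := inv_ne_zero (hb0 l hl)
    have hFsurj := surjective_of_tendsto_div (hFc l hl) hane hlim
    have hfsurj : Function.Surjective (f l) := by
      intro q
      induction q using OnePoint.rec with
      | infty => exact ⟨OnePoint.infty, hinf l hl⟩
      | coe w =>
        obtain ⟨z, rfl⟩ := hFsurj w
        exact ⟨z, hFf l hl z⟩
    have hfc : Continuous (f l) := by
      rw [continuous_iff_continuousAt]
      intro p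
      induction p using OnePoint.rec with
      | infty =>
        exact ((hhol l hl).mdifferentiableAt
          ((isOpen_sphereCompl hK).mem_nhds (infty_mem_sphereCompl K))).continuousAt
      | coe z =>
        rw [OnePoint.continuousAt_coe]
        have : f l ∘ (fun z : ℂ => (z : RiemannSphere)) = fun z => ((F l z : ℂ) : RiemannSphere) :=
          funext fun z => hFf l hl z
        change ContinuousAt (f l ∘ (fun z : ℂ => (z : RiemannSphere))) z
        rw [this]
        exact (OnePoint.continuous_coe.comp (hFc l hl)).continuousAt
    let Φ : RiemannSphere ≃ₜ RiemannSphere :=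
      Continuous.homeoOfEquivCompactToT2 (f := Equiv.ofBijective (f l) ⟨hfinj l hl, hfsurj⟩) hfc
    exact analyticCapacity_eq_norm_mul hK Φ (hFf l hl) (hinf l hl) (hhol l hl) (hmoved l hl)
      hane hlim
  have hb1 : invDerivInfty (F 0) = 1 := by
    simp [invDerivInfty, hF0]
  intro l hl
  have hpos : 0 < analyticCapacity (movedSet f K l) := by
    rw [hcap l hl]
    exact mul_pos (norm_pos_iff.2 (inv_ne_zero (hb0 l hl))) hγ
  have hlog : ∀ m ∈ Metric.ball (0 : ℂ) 1, M / analyticCapacity K / ‖(invDerivInfty (F m))⁻¹‖ =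
      M / analyticCapacity (movedSet f K m) := by
    intro m hm
    rw [hcap m hm, div_div, mul_comm (analyticCapacity K)]
  -- The bound `M` on the capacities is the bound `M / γ(K)` on the derivative at `∞`, which equals
  -- `1` at parameter `0`.
  have hH := harnack_log_norm (φ := fun m => (invDerivInfty (F m))⁻¹) (B := M / analyticCapacity K)
    ((differentiableOn_invDerivInfty hR hFd hFinj hG).fun_inv hb0)
    (fun m hm => inv_ne_zero (hb0 m hm))
    (fun m hm => by
      rw [le_div_iff₀ hγ, ← hcap m hm]
      exact hM m hm) hl
  simp only [hlog l hl, hb1, inv_one, norm_one, div_one] at hH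
  have hl1 : ‖l‖ < 1 := by simpa using hl
  have hl0 := norm_nonneg l
  refine ⟨hmoved l hl ▸ hK.image (hFc l hl), hpos, fun hlt => ?_, fun heq => ?_⟩
  · have hm : 0 < Real.log (M / analyticCapacity K) := Real.log_pos ((one_lt_div hγ).2 hlt)
    constructor
    · rw [div_le_div_iff₀ (by linarith) hm]
      linarith [hH.2]
    · rw [div_le_div_iff₀ hm (by linarith)]
      linarith [hH.1]
  · have hMpos : 0 < M := heq ▸ hγ
    rw [heq, div_self hMpos.ne', Real.log_one, mul_zero] at hH
    refine le_antisymm (hM l hl) ?_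
    -- Here the value at parameter `0` is zero, the minimum, and Harnack forces zero everywhere.
    have h1 : Real.log (M / analyticCapacity (movedSet f K l)) ≤ 0 := by
      by_contra h
      rw [not_le] at h
      linarith [hH.1, mul_pos (sub_pos.2 hl1) h]
    rw [Real.log_nonpos_iff (by positivity), div_le_one hpos] at h1
    exact h1
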